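/- A subset $S$ of a space $X$ is \emph{$C^*$-embedded} if every bounded continuous $f:S\to\mathbb R$ has a bounded continuous extension to $X$. A space is \emph{realcompact} if it can be embedded as a closed subset in a power of $\mathbb R$. A \emph{closed copy of $\mathbb N$} in $X$ is a closed subset of $X$ that, with the subspace topology, is homeomorphic to the discrete space $\mathbb N$. Let $D=2^{<\omega}$ be the set of finite $0$-$1$-sequences with the discrete topology, and let $cD=D\cup 2^\omega$ be topologized by making the points of $D$ isolated and giving $x\in2^\omega$ the neighbourhood base of all wedges $U(x,n)=\{s\in cD: x{\restriction}n\subseteq s\}$, $n\in\omega$; this is a Hausdorff compactification of $D$. Let $e:\beta D\to cD$ be the continuous extension of the identity map of $D$, let $D^*=\beta D\setminus D$, and let $K_x=\{u\in D^*:e(u)=x\}$ for $x\in2^\omega$. Let $\mathbb C=2^\omega\cup\{\infty\}$, where the points of $2^\omega$ are isolated and the sets that contain $\infty$ and have countable complement form a neighbourhood base at $\infty$. Let $$\mathbb A=(\mathbb C\times D)\cup\bigcup_{x\in2^\omega}\{x\}\times K_x$$ be given the topology of a subspace of $\mathbb C\times\beta D$, and put $T=\bigcup_{x\in2^\omega}\{x\}\times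 K_x$ (the top line) and $R=\{\infty\}\times D$. Let $Q$ be the quotient space of $\mathbb A\times\{0,1\}$ obtained by identifying $(t,0)$ and $(t,1)$ for every $t\in T$, and let $R_i$ be the image of $R\times\{i\}$ in $Q$ ($i=0,1$). Then: 1. $Q$ is realcompact. 2. $R_0$ and $R_1$ are disjoint closed copies of $\mathbb N$ in $Q$, and each of them is $C^*$-embedded in $Q$. 3. $R_0\cup R_1$ is a closed copy of $\mathbb N$ in $Q$ that is not $C^*$-embedded in $Q$. 4. The set $C(Q)$ of continuous functions $Q\to\mathbb R$ has cardinality $\mathfrak c$. 5. For every set $I$ of cardinality $\mathfrak c$ there is an embedding $\varphi$ of $Q$ onto a closed subset of $\mathbb R^I$ such that $\varphi[R_0\cup R_1]$ is a closed copy of $\mathbb N$ in $\mathbb R^I$ that is not $C^*$-embedded in $\mathbb R^I$. In particular, $\mathbb R^{\mathfrak c}$ contains a closed copy of $\mathbb N$ that is not $C^*$-embedded. 6. Consequently, it is not true that in every realcompact space the union of two $C^*$-embedded closed copies of $\mathbb N$ is $C^*$-embedded. -/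

import Mathlib

open Topology Set

universe u

/-- A subset `S` of `X` is `C*`-embedded if every bounded continuous `f : S → ℝ` admits a
bounded continuous extension to `X`. -/
def CStarEmbedded {X : Type*} [TopologicalSpace X] (S : Set X) : Prop :=
  ∀ f : BoundedContinuousFunction S ℝ, ∃ g : BoundedContinuousFunction X ℝ,
    ∀ x : S, g (x : X) = f x

/-- `X` is realcompact if it is homeomorphic to a closed subset of some power of the real line. -/
def Realcompact (X : Type u) [TopologicalSpace X] : Prop :=
  ∃ (I : Type u) (φ : X → (I → ℝ)), IsClosedEmbedding φ

/-- A closed copy of `ℕ` in `X`: a closed subset whose subspace topology is that of the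
discrete space `ℕ`. -/
def IsClosedCopyOfNat {X : Type*} [TopologicalSpace X] (S : Set X) : Prop :=
  IsClosed S ∧ Nonempty (S ≃ₜ ℕ)

namespace Plank

/-- The tree `D = 2^{<ω}` of finite 0-1-sequences. -/
def D : Type := List Bool

/-- `D` carries the discrete topology. -/
instance : TopologicalSpace D := ⊥

instance : DiscreteTopology D := ⟨rfl⟩

/-- The set `cD = D ∪ 2^ω` of all finite and infinite 0-1-sequences. -/
inductive CD : Type
  | node (s : D) : CD
  | branch (x : ℕ → Bool) : CD

/-- A finite or infinite sequence viewed as a partial function on `ℕ`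
(`none` where it is undefined). -/
def CD.val : CD → ℕ → Option Bool
  | .node s, i => (show List Bool from s)[i]?
  | .branch x, i => some (x i)

/-- The wedge `U(x, n) = {s ∈ cD : x ↾ n ⊆ s}`. -/
def wedge (x : ℕ → Bool) (n : ℕ) : Set CD :=
  {t | ∀ i < n, t.val i = some (x i)}

/-- The topology of `cD`: the points of `D` are isolated, and the wedges `U(x, n)`, `n ∈ ℕ`,
form a neighbourhood base at `x ∈ 2^ω`. -/
instance : TopologicalSpace CD where
  IsOpen W := ∀ x, CD.branch x ∈ W → ∃ n, wedge x n ⊆ W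
  isOpen_univ := fun _ _ => ⟨0, subset_univ _⟩
  isOpen_inter := by
    intro V W hV hW x hx
    obtain ⟨n, hn⟩ := hV x hx.1
    obtain ⟨m, hm⟩ := hW x hx.2
    exact ⟨max n m, fun t ht => ⟨hn fun i hi => ht i (lt_of_lt_of_le hi (le_max_left _ _)),
      hm fun i hi => ht i (lt_of_lt_of_le hi (le_max_right _ _))⟩⟩
  isOpen_sUnion := by
    intro S hS x hx
    obtain ⟨W, hW, hxW⟩ := hx
    obtain ⟨n, hn⟩ := hS W hW x hxW
    exact ⟨n, hn.trans (subset_sUnion_of_mem hW)⟩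

theorem CD.isOpen_iff {W : Set CD} :
    IsOpen W ↔ ∀ x, CD.branch x ∈ W → ∃ n, wedge x n ⊆ W := Iff.rfl

theorem CD.isOpen_coord (i : ℕ) (v : Option Bool) : IsOpen {t : CD | t.val i = v} := by
  rw [CD.isOpen_iff]
  intro x hx
  refine ⟨i + 1, fun t ht => ?_⟩
  exact (ht i (Nat.lt_succ_self i)).trans hx

theorem CD.isOpen_node (s : D) : IsOpen {CD.node s} := by
  rw [CD.isOpen_iff]
  intro x hx
  cases hx

theorem CD.val_node_eq_none_iff (s : D) (i : ℕ) :
    (CD.node s).val i = none ↔ List.length s ≤ i :=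
  List.getElem?_eq_none_iff

theorem CD.val_injective : Function.Injective CD.val := by
  rintro (s | x) (t | y) h
  · exact congrArg CD.node (List.ext_getElem? fun i => congrFun h i)
  · have h1 := congrFun h (List.length s)
    exact absurd ((CD.val_node_eq_none_iff s _).2 le_rfl) (h1 ▸ Option.some_ne_none _)
  · have h1 := congrFun h (List.length t)
    exact absurd ((CD.val_node_eq_none_iff t _).2 le_rfl) (h1 ▸ Option.some_ne_none _)
  · exact congrArg CD.branch (funext fun i => Option.some.inj (congrFun h i))

instance : T2Space CD where
  t2 := by
    intro t t' h
    obtain ⟨i, hi⟩ := Function.ne_iff.1 (CD.val_injective.ne h)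
    refine ⟨_, _, CD.isOpen_coord i (t.val i), CD.isOpen_coord i (t'.val i), rfl, rfl, ?_⟩
    rw [Set.disjoint_left]
    intro z hz hz'
    exact hi (Eq.trans (Eq.symm hz) hz')

instance : CompactSpace CD where
  isCompact_univ := by
    rw [isCompact_iff_ultrafilter_le_nhds]
    intro F _
    have h1 : ∀ i, ∃ v : Option Bool, {t : CD | t.val i = v} ∈ F := by
      intro i
      obtain ⟨v, hv⟩ := Ultrafilter.eq_pure_of_finite (F.map (fun t => t.val i))
      refine ⟨v, ?_⟩
      have h2 : ({v} : Set (Option Bool)) ∈ F.map (fun t => t.val i) := by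
        rw [hv]; exact rfl
      exact h2
    choose v hv using h1
    have hfin : ∀ n, {t : CD | ∀ i < n, t.val i = v i} ∈ F := by
      intro n
      have h3 := (Filter.biInter_mem (f := (F : Filter CD)) (s := fun i => {t : CD | t.val i = v i})
        (Set.finite_Iio n)).2 fun i _ => hv i
      refine Filter.mem_of_superset h3 fun t ht i hi => ?_
      exact Set.mem_iInter₂.1 ht i hi
    by_cases hall : ∀ i, ∃ b, v i = some b
    · choose x hx using hall
      refine ⟨CD.branch x, mem_univ _, fun W hW => ?_⟩
      obtain ⟨V, hVW, hV, hxV⟩ := mem_nhds_iff.1 hW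
      obtain ⟨n, hn⟩ := CD.isOpen_iff.1 hV x hxV
      exact Filter.mem_of_superset (hfin n)
        fun t ht => hVW (hn fun i hi => (ht i hi).trans (hx i))
    · push Not at hall
      obtain ⟨i, hi⟩ := hall
      have hvi : v i = none := Option.eq_none_iff_forall_ne_some.2 hi
      obtain ⟨t, ht⟩ := F.nonempty_of_mem (hfin (i + 1))
      have hsub : {t : CD | ∀ j < i + 1, t.val j = v j} ⊆ {t} := by
        intro t' ht'
        have key : ∀ z : CD, (∀ j < i + 1, z.val j = v j) → ∀ j, i ≤ j → z.val j = none := by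
          rintro (s | x) hz j hj
          · have h4 := (hz i (Nat.lt_succ_self i)).trans hvi
            exact (CD.val_node_eq_none_iff s j).2 (((CD.val_node_eq_none_iff s i).1 h4).trans hj)
          · have h4 := (hz i (Nat.lt_succ_self i)).trans hvi
            simp [CD.val] at h4
        refine CD.val_injective (funext fun j => ?_)
        rcases lt_or_ge j (i + 1) with hj | hj
        · exact (ht' j hj).trans (ht j hj).symm
        · exact (key t' ht' j (by omega)).trans (key t ht j (by omega)).symm
      refine ⟨t, mem_univ _, fun W hW => ?_⟩
      exact Filter.mem_of_superset (hfin (i + 1))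
        (hsub.trans (singleton_subset_iff.2 (mem_of_mem_nhds hW)))

/-- The map `e : βD → cD` that extends the identity map of `D`. -/
noncomputable def e : StoneCech D → CD :=
  stoneCechExtend (g := CD.node) continuous_of_discreteTopology

/-- `D* = βD \ D`. -/
def remainder : Set (StoneCech D) := (range (stoneCechUnit : D → StoneCech D))ᶜ

/-- `K_x = {u ∈ D* : e(u) = x}`. -/
def K (x : ℕ → Bool) : Set (StoneCech D) := {u | u ∈ remainder ∧ e u = CD.branch x}

/-- The set `ℂ = 2^ω ∪ {∞}`. -/
inductive C : Type
  | pt (x : ℕ → Bool) : C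
  | infty : C

/-- The points of `2^ω` are isolated in `ℂ`, and the sets that contain `∞` and have a countable
complement form a neighbourhood base at `∞`. -/
instance : TopologicalSpace C where
  IsOpen U := C.infty ∈ U → Uᶜ.Countable
  isOpen_univ := by simp
  isOpen_inter := by
    intro U V hU hV h
    rw [compl_inter]
    exact (hU h.1).union (hV h.2)
  isOpen_sUnion := by
    intro S hS h
    obtain ⟨U, hU, hxU⟩ := h
    exact (hS U hU hxU).mono (compl_subset_compl.2 (subset_sUnion_of_mem hU))

/-- The underlying set `(ℂ × D) ∪ ⋃ₓ {x} × K_x` of the plank `𝔸`. -/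
def plankSet : Set (C × StoneCech D) :=
  (univ ×ˢ range (stoneCechUnit : D → StoneCech D)) ∪ ⋃ x : ℕ → Bool, {C.pt x} ×ˢ K x

/-- The plank `𝔸`, as a subspace of `ℂ × βD`. -/
abbrev A : Type := plankSet

/-- The top line `T = ⋃ₓ {x} × K_x`. -/
def T : Set A := {a | (a : C × StoneCech D) ∈ ⋃ x : ℕ → Bool, {C.pt x} ×ˢ K x}

/-- The right-hand side `R = {∞} × D`. -/
def R : Set A :=
  {a | (a : C × StoneCech D) ∈ {C.infty} ×ˢ range (stoneCechUnit : D → StoneCech D)}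

/-- The equivalence relation on `𝔸 × {0, 1}` that identifies `(t, 0)` and `(t, 1)` for
every `t ∈ T`. -/
def glue : Setoid (A × Fin 2) where
  r p q := p.1 = q.1 ∧ (p.2 = q.2 ∨ p.1 ∈ T)
  iseqv :=
    { refl := fun _ => ⟨rfl, Or.inl rfl⟩
      symm := fun {_ _} h => ⟨h.1.symm, h.2.elim (fun h1 => Or.inl h1.symm)
        (fun h1 => Or.inr (h.1 ▸ h1))⟩
      trans := fun {_ _ _} h k => ⟨h.1.trans k.1, h.2.elim
        (fun h1 => k.2.elim (fun k1 => Or.inl (h1.trans k1))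
          (fun k1 => Or.inr (h.1.symm ▸ k1))) Or.inr⟩ }

/-- The quotient of `𝔸 × {0, 1}` under this relation, with the quotient topology. -/
abbrev Q : Type := Quotient glue

/-- The copy `R × {i}` of the right-hand side in the quotient. -/
def RCopy (i : Fin 2) : Set Q := (fun p : A × Fin 2 => Quotient.mk glue p) '' (R ×ˢ {i})

end Plank

/-! A continuous function on `ℂ` is constant off a countable set. Since `D` is countable, every
continuous `g : Q → ℝ` therefore has some `x` such that `g` takes the same values on
`{x} × D × {i}` as on `{∞} × D × {i}`, for both `i`. If `g` were `0` on `R₀` and `1` on `R₁`, then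
by density it would be `0` and `1` on the two copies of `{x} × K_x`, which are glued together.
The same countability bounds the number of continuous functions on `Q`.

For realcompactness, every point of `ℂ × βD` outside `𝔸` lies in a countable intersection of clopen
sets that misses `𝔸`. Countably many clopen members of a real ultrafilter have a common point, so a
real ultrafilter on `𝔸` cannot converge to a point outside `𝔸`. The folding map `Q → 𝔸`
is perfect, so `Q` inherits the convergence of real ultrafilters from `𝔸`. -/

open Filter

section RealUltrafilters

variable {X Y : Type*} [TopologicalSpace X] [TopologicalSpace Y]

/-- An ultrafilter `U` on `X` is real if every continuous real-valued function on `X` has a finite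
limit along `U`. -/
def IsRealUltrafilter (U : Ultrafilter X) : Prop :=
  ∀ f : C(X, ℝ), ∃ r, Tendsto f U (𝓝 r)

variable (X) in
/-- Every real ultrafilter on `X` converges. For Tychonoff spaces this is realcompactness; unlike
`Realcompact` it passes directly to products, perfect preimages and `Gδ`-closed subspaces. -/
def RealUltrafiltersConverge : Prop :=
  ∀ U : Ultrafilter X, IsRealUltrafilter U → ∃ x, (U : Filter X) ≤ 𝓝 x

namespace IsRealUltrafilter

variable {U : Ultrafilter X}

theorem map (hU : IsRealUltrafilter U) {φ : X → Y} (hφ : Continuous φ) :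
    IsRealUltrafilter (U.map φ) :=
  fun f => hU (f.comp ⟨φ, hφ⟩)

theorem exists_eventually_eq (hU : IsRealUltrafilter U) {k : X → ℕ} (hk : Continuous k) :
    ∃ n, ∀ᶠ x in U, k x = n := by
  obtain ⟨r, hr⟩ := hU ⟨fun x => (k x : ℝ), continuous_of_discreteTopology.comp hk⟩
  obtain ⟨n, rfl⟩ : r ∈ range ((↑) : ℕ → ℝ) :=
    Nat.isClosedEmbedding_coe_real.isClosed_range.mem_of_tendsto hr
      (Eventually.of_forall fun x => mem_range_self (k x))
  have hn : Tendsto k U (𝓝 n) := Nat.isClosedEmbedding_coe_real.tendsto_nhds_iff.2 hr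
  rw [nhds_discrete, tendsto_pure] at hn
  exact ⟨n, hn⟩

/-- If the intersection were empty, the index of the first `W n` missing `x` would be a continuous
function of `x`, hence constant on a set in `U`; that set would miss some `W n`. -/
theorem nonempty_iInter_of_isClopen (hU : IsRealUltrafilter U) {W : ℕ → Set X}
    (hW : ∀ n, IsClopen (W n)) (hWU : ∀ n, W n ∈ U) : (⋂ n, W n).Nonempty := by
  classical
  by_contra! hempty
  have hmiss : ∀ x, ∃ n, x ∉ W n := by
    simpa only [eq_empty_iff_forall_notMem, mem_iInter, not_forall] using hempty
  have hfiber : ∀ n, (fun x => Nat.find (hmiss x)) ⁻¹' {n} = (W n)ᶜ ∩ ⋂ m ∈ Iio n, W m := by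
    intro n
    ext x
    simp [Nat.find_eq_iff]
  have hcont : Continuous fun x => Nat.find (hmiss x) := by
    refine (IsLocallyConstant.iff_isOpen_fiber.2 fun n => ?_).continuous
    rw [hfiber]
    exact (hW n).compl.isOpen.inter ((finite_Iio n).isOpen_biInter fun m _ => (hW m).isOpen)
  obtain ⟨n, hn⟩ := hU.exists_eventually_eq hcont
  obtain ⟨x, hxn, hxW⟩ := (hn.and (hWU n)).exists
  exact (hxn ▸ Nat.find_spec (hmiss x)) hxW

end IsRealUltrafilter

namespace RealUltrafiltersConverge

theorem of_compactSpace [CompactSpace X] : RealUltrafiltersConverge X := fun U _ =>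
  ⟨U.lim, U.le_nhds_lim⟩

theorem prod (hX : RealUltrafiltersConverge X) (hY : RealUltrafiltersConverge Y) :
    RealUltrafiltersConverge (X × Y) := by
  intro U hU
  obtain ⟨x, hx⟩ := hX _ (hU.map continuous_fst)
  obtain ⟨y, hy⟩ := hY _ (hU.map continuous_snd)
  exact ⟨(x, y), Tendsto.prodMk_nhds hx hy⟩

theorem of_isProperMap {p : X → Y} (hY : RealUltrafiltersConverge Y) (hp : IsProperMap p) :
    RealUltrafiltersConverge X := by
  intro U hU
  obtain ⟨y, hy⟩ := hY _ (hU.map hp.continuous)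
  obtain ⟨x, -, hx⟩ := hp.ultrafilter_le_nhds_of_tendsto hy
  exact ⟨x, hx⟩

theorem subtype (hX : RealUltrafiltersConverge X) {S : Set X}
    (hS : ∀ x ∉ S, ∃ W : ℕ → Set X, (∀ n, IsClopen (W n) ∧ x ∈ W n) ∧ ⋂ n, W n ⊆ Sᶜ) :
    RealUltrafiltersConverge S := by
  intro U hU
  obtain ⟨x, hx⟩ := hX _ (hU.map continuous_subtype_val)
  have hxS : x ∈ S := by
    by_contra hxS
    obtain ⟨W, hW, hWS⟩ := hS x hxS
    obtain ⟨s, hs⟩ := hU.nonempty_iInter_of_isClopen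
      (fun n => (hW n).1.preimage continuous_subtype_val)
      (fun n => hx ((hW n).1.isOpen.mem_nhds (hW n).2))
    rw [← preimage_iInter] at hs
    exact hWS hs s.2
  exact ⟨⟨x, hxS⟩, tendsto_subtype_rng.2 hx⟩

end RealUltrafiltersConverge

theorem isClosedEmbedding_pi_of_ultrafilter {ι : Type*} {Z : ι → Type*}
    [∀ i, TopologicalSpace (Z i)] [∀ i, T2Space (Z i)] (F : ∀ i, C(X, Z i))
    (hsep : Pairwise fun x y => ∃ i, F i x ≠ F i y)
    (hlim : ∀ U : Ultrafilter X, (∀ i, ∃ z, Tendsto (F i) U (𝓝 z)) → ∃ x, (U : Filter X) ≤ 𝓝 x) :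
    IsClosedEmbedding fun x i => F i x := by
  have hcont : Continuous fun x i => F i x := continuous_pi fun i => (F i).continuous
  have hinj : Function.Injective fun x i => F i x := by
    intro x y hxy
    by_contra hne
    obtain ⟨i, hi⟩ := hsep hne
    exact hi (congrFun hxy i)
  have hproper : IsProperMap fun x i => F i x := by
    refine isProperMap_iff_ultrafilter.2 ⟨hcont, fun U z hz => ?_⟩
    obtain ⟨x, hx⟩ := hlim U fun i => ⟨z i, tendsto_pi_nhds.1 hz i⟩
    exact ⟨x, tendsto_nhds_unique ((hcont.tendsto x).mono_left hx) hz, hx⟩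
  exact .of_continuous_injective_isClosedMap hcont hinj hproper.isClosedMap

theorem exists_isClopen_of_apply_ne [TotallySeparatedSpace Y] {f : X → Y} (hf : Continuous f)
    {x y : X} (h : f x ≠ f y) : ∃ V : Set X, IsClopen V ∧ x ∈ V ∧ y ∈ Vᶜ := by
  obtain ⟨V, hV, hx, hy⟩ := exists_isClopen_of_totally_separated h
  exact ⟨f ⁻¹' V, hV.preimage hf, hx, hy⟩

theorem exists_continuousMap_apply_ne [TotallySeparatedSpace X] :
    Pairwise fun x y : X => ∃ f : C(X, ℝ), f x ≠ f y := by
  intro x y hxy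
  obtain ⟨V, hV, hx, hy⟩ := exists_isClopen_of_totally_separated hxy
  refine ⟨(BoundedContinuousFunction.indicator V hV).toContinuousMap, ?_⟩
  simp [hx, notMem_of_mem_compl hy]

theorem RealUltrafiltersConverge.isClosedEmbedding_eval [TotallySeparatedSpace X]
    (hX : RealUltrafiltersConverge X) {ι : Type*} {F : ι → C(X, ℝ)} (hF : Function.Surjective F) :
    IsClosedEmbedding fun x i => F i x := by
  refine isClosedEmbedding_pi_of_ultrafilter F (fun x y hxy => ?_) fun U hU => hX U fun f => ?_
  · obtain ⟨f, hf⟩ := exists_continuousMap_apply_ne hxy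
    obtain ⟨i, rfl⟩ := hF f
    exact ⟨i, hf⟩
  · obtain ⟨i, rfl⟩ := hF f
    exact hU i

theorem RealUltrafiltersConverge.realcompact [TotallySeparatedSpace X]
    (hX : RealUltrafiltersConverge X) : Realcompact X :=
  ⟨_, _, hX.isClosedEmbedding_eval Function.surjective_id⟩

theorem RealUltrafiltersConverge.exists_isClosedEmbedding_pi [TotallySeparatedSpace X]
    (hX : RealUltrafiltersConverge X) {I : Type*} (hI : Nonempty (C(X, ℝ) ↪ I)) :
    ∃ φ : X → I → ℝ, IsClosedEmbedding φ := by
  obtain ⟨E⟩ := hI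
  exact ⟨_, hX.isClosedEmbedding_eval (Function.invFun_surjective E.injective)⟩

end RealUltrafilters

section ClosedCopies

variable {X Y : Type*} [TopologicalSpace X] [TopologicalSpace Y]

theorem IsClosedCopyOfNat.range {N : Type*} [TopologicalSpace N] [DiscreteTopology N]
    [Countable N] [Infinite N] {j : N → X} (hj : IsClosedEmbedding j) :
    IsClosedCopyOfNat (range j) := by
  obtain ⟨a⟩ : Nonempty (N ≃ ℕ) := nonempty_equiv_of_countable
  exact ⟨hj.isClosed_range, ⟨hj.isEmbedding.toHomeomorph.symm.trans a.toHomeomorphOfDiscrete⟩⟩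

theorem IsClosedCopyOfNat.image {φ : X → Y} (hφ : IsClosedEmbedding φ) {S : Set X}
    (hS : IsClosedCopyOfNat S) : IsClosedCopyOfNat (φ '' S) :=
  ⟨hφ.isClosedMap S hS.1, hS.2.map fun h => (hφ.isEmbedding.homeomorphImage S).symm.trans h⟩

theorem isClosedEmbedding_of_isOpen_separating {N : Type*} [TopologicalSpace N]
    [DiscreteTopology N] {j : N → X} (hj : IsClosed (range j)) {W : N → Set X}
    (hW : ∀ n, IsOpen (W n)) (hjW : ∀ m n, j m ∈ W n ↔ m = n) : IsClosedEmbedding j := by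
  have hinj : Function.Injective j := fun m n h => (hjW m n).1 (h ▸ (hjW n n).2 rfl)
  refine ⟨⟨isInducing_iff_nhds.2 fun n => ?_, hinj⟩, hj⟩
  refine le_antisymm (continuous_of_discreteTopology (f := j)).continuousAt.tendsto.le_comap ?_
  rw [nhds_discrete N, le_pure_iff]
  refine ⟨W n, (hW n).mem_nhds ((hjW n n).2 rfl), fun m hm => (hjW m n).1 hm⟩

namespace CStarEmbedded

theorem of_image {φ : X → Y} (hφ : IsEmbedding φ) {S : Set X} (hS : CStarEmbedded (φ '' S)) :
    CStarEmbedded S := by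
  intro f
  let h := hφ.homeomorphImage S
  obtain ⟨g, hg⟩ := hS (f.compContinuous ⟨h.symm, h.symm.continuous⟩)
  refine ⟨g.compContinuous ⟨φ, hφ.continuous⟩, fun x => ?_⟩
  exact (hg (h x)).trans (congrArg f (h.symm_apply_apply x))

theorem range_of_comp_eq_stoneCechUnit {N : Type*} [TopologicalSpace N] {j : N → X}
    (hj : Continuous j) {r : X → StoneCech N} (hr : Continuous r)
    (hrj : ∀ n, r (j n) = stoneCechUnit n) : CStarEmbedded (range j) := by
  intro f
  let h : N → Icc (-‖f‖) ‖f‖ := fun n =>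
    ⟨f ⟨j n, mem_range_self n⟩, abs_le.1 (f.norm_coe_le_norm _)⟩
  have hh : Continuous h := by fun_prop
  let g : X → ℝ := fun x => (stoneCechExtend hh (r x)).1
  have hg : Continuous g :=
    continuous_subtype_val.comp ((continuous_stoneCechExtend hh).comp hr)
  refine ⟨.ofNormedAddCommGroup g hg ‖f‖ fun x => abs_le.2 (stoneCechExtend hh _).2, ?_⟩
  rintro ⟨_, n, rfl⟩
  change (stoneCechExtend hh (r (j n))).1 = f ⟨j n, mem_range_self n⟩
  rw [hrj, stoneCechExtend_stoneCechUnit]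

theorem exists_eqOn_zero_one {S T : Set X} (h : CStarEmbedded (S ∪ T)) (hS : IsClosed S)
    (hT : IsClosed T) (hST : Disjoint S T) :
    ∃ g : C(X, ℝ), (∀ x ∈ S, g x = 0) ∧ ∀ x ∈ T, g x = 1 := by
  have hcompl : ((↑) ⁻¹' T : Set ↥(S ∪ T))ᶜ = (↑) ⁻¹' S := by
    ext ⟨x, hx⟩
    exact ⟨fun hxT => hx.resolve_right hxT, fun hxS => hST.notMem_of_mem_left hxS⟩
  have hclopen : IsClopen ((↑) ⁻¹' T : Set ↥(S ∪ T)) := by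
    refine ⟨hT.preimage continuous_subtype_val, isClosed_compl_iff.1 ?_⟩
    rw [hcompl]
    exact hS.preimage continuous_subtype_val
  obtain ⟨g, hg⟩ := h (.indicator _ hclopen)
  refine ⟨g.toContinuousMap, fun x hx => ?_, fun x hx => ?_⟩
  · refine (hg ⟨x, Or.inl hx⟩).trans ?_
    simp [hST.notMem_of_mem_left hx]
  · refine (hg ⟨x, Or.inr hx⟩).trans ?_
    simp [hx]

end CStarEmbedded

end ClosedCopies

theorem mk_countable_support_le (α β : Type u) [Zero β] :
    Cardinal.mk {f : α → β // (Function.support f).Countable} ≤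
      max (Cardinal.mk (α × β)) Cardinal.aleph0 ^ Cardinal.aleph0 := by
  let graph (f : {f : α → β // (Function.support f).Countable}) :
      {t : Set (α × β) // Cardinal.mk t ≤ Cardinal.aleph0} :=
    ⟨(fun a => (a, f.1 a)) '' Function.support f.1, (f.2.image _).le_aleph0⟩
  have mem_graph (f) {a : α} {b : β} (hb : b ≠ 0) : (a, b) ∈ (graph f).1 ↔ f.1 a = b := by
    simp only [graph, mem_image, Function.mem_support, Prod.mk.injEq]
    exact ⟨fun ⟨_, _, ha, hfb⟩ => ha ▸ hfb, fun h => ⟨a, h ▸ hb, rfl, h⟩⟩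
  have graph_injective : Function.Injective graph := by
    intro f g hfg
    ext a
    by_cases hf : f.1 a = 0
    · by_contra hne
      have hg : g.1 a ≠ 0 := fun h => hne (hf.trans h.symm)
      exact hne ((mem_graph f hg).1 (hfg ▸ (mem_graph g hg).2 rfl))
    · exact ((mem_graph g hf).1 (hfg ▸ (mem_graph f hf).2 rfl)).symm
  exact (Cardinal.mk_le_of_injective graph_injective).trans (Cardinal.mk_bounded_set_le _ _)

theorem apply_eq_apply_iff_of_isOpen_singleton {X Y Z : Type*} [TopologicalSpace Y] [T1Space Y]
    [TopologicalSpace Z] {j : X → Y} (hj : DenseRange j) {f : Y → Z} (hf : Continuous f)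
    (hfj : Function.Injective (f ∘ j)) {x : X} (hx : IsOpen {f (j x)}) {y : Y} :
    f y = f (j x) ↔ y = j x := by
  refine ⟨fun h => ?_, fun h => h ▸ rfl⟩
  by_contra hne
  obtain ⟨x', hx', hne'⟩ := hj.exists_mem_open
    ((hx.preimage hf).inter isOpen_compl_singleton) ⟨y, h, hne⟩
  exact hne' (congrArg j (hfj hx'))


namespace Plank

instance : Countable D := inferInstanceAs (Countable (List Bool))

instance : Infinite D := inferInstanceAs (Infinite (List Bool))

instance : TotallySeparatedSpace (StoneCech D) :=
  have := CompactT2.Projective.extremallyDisconnected (StoneCech.projective (X := D))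
  inferInstance

namespace C

theorem isOpen_iff {V : Set C} : IsOpen V ↔ (infty ∈ V → Vᶜ.Countable) := Iff.rfl

theorem pt_injective : Function.Injective pt := fun _ _ h => C.pt.inj h

theorem isClopen_of_countable {S : Set C} (hS : S.Countable) (hinf : infty ∉ S) : IsClopen S :=
  ⟨⟨isOpen_iff.2 fun _ => (compl_compl S).symm ▸ hS⟩, isOpen_iff.2 fun h => absurd h hinf⟩

theorem isClopen_pt (x : ℕ → Bool) : IsClopen {pt x} :=
  isClopen_of_countable (countable_singleton _) (by simp)

theorem isClosed_infty : IsClosed {infty} :=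
  ⟨isOpen_iff.2 fun h => absurd rfl h⟩

instance : TotallySeparatedSpace C := by
  refine totallySeparatedSpace_iff_exists_isClopen.2 ?_
  rintro (x | _) c hne
  · exact ⟨{pt x}, isClopen_pt x, rfl, hne.symm⟩
  · rcases c with y | _
    · exact ⟨{pt y}ᶜ, (isClopen_pt y).compl, hne, fun h => h rfl⟩
    · exact absurd rfl hne

theorem realUltrafiltersConverge : RealUltrafiltersConverge C := by
  intro U hU
  by_contra! hlim
  obtain ⟨V, hinf, hV, hVU⟩ : ∃ V, infty ∈ V ∧ IsOpen V ∧ V ∉ (U : Filter C) := by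
    simpa only [le_nhds_iff, not_forall, exists_prop] using hlim infty
  have hVc : Vᶜ ∈ U := Ultrafilter.compl_mem_iff_notMem.2 hVU
  have hcount : Vᶜ.Countable := isOpen_iff.1 hV hinf
  obtain ⟨s, hs⟩ := hcount.exists_eq_range (U.nonempty_of_mem hVc)
  have hpoint : ∀ c, {c}ᶜ ∈ U := by
    intro c
    refine Ultrafilter.compl_mem_iff_notMem.2 fun hc => hlim c ?_
    exact (le_pure_iff.2 hc).trans (pure_le_nhds c)
  obtain ⟨c, hc⟩ := hU.nonempty_iInter_of_isClopen (W := fun n => Vᶜ ∩ {s n}ᶜ)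
    (fun n => isClopen_of_countable (hcount.mono inter_subset_left) fun h => h.1 hinf)
    (fun n => inter_mem hVc (hpoint (s n)))
  rw [mem_iInter] at hc
  obtain ⟨n, rfl⟩ : c ∈ range s := hs ▸ (hc 0).1
  exact (hc n).2 rfl

theorem countable_compl_of_isGδ {G : Set C} (hG : IsGδ G) (hinf : infty ∈ G) :
    Gᶜ.Countable := by
  obtain ⟨S, hopen, hcount, rfl⟩ := hG
  rw [compl_sInter]
  exact (hcount.image _).sUnion <| forall_mem_image.2 fun V hV =>
    isOpen_iff.1 (hopen V hV) (hinf V hV)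

theorem exists_pt_mem_of_isGδ {G : Set C} (hG : IsGδ G) (hinf : infty ∈ G) :
    ∃ x, pt x ∈ G := by
  have : Uncountable (ℕ → Bool) := by
    simp [← Cardinal.aleph0_lt_mk_iff, Cardinal.aleph0_lt_continuum]
  by_contra! h
  refine not_countable_univ (((countable_compl_of_isGδ hG hinf).preimage pt_injective).mono ?_)
  exact fun x _ => h x

theorem mk_le_continuum : Cardinal.mk C ≤ Cardinal.continuum := by
  have hsurj : Function.Surjective fun o : Option (ℕ → Bool) => o.elim infty pt := by
    rintro (x | _)
    exacts [⟨some x, rfl⟩, ⟨none, rfl⟩]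
  calc
    _ ≤ _ := Cardinal.mk_le_of_surjective hsurj
    _ = Cardinal.continuum := by simp [Cardinal.add_one_eq Cardinal.aleph0_le_continuum]

theorem mk_continuousMap_le_continuum : Cardinal.mk C(C, ℝ) ≤ Cardinal.continuum := by
  let decompose (f : C(C, ℝ)) : ℝ × {g : C → ℝ // (Function.support g).Countable} :=
    ⟨f infty, fun z => f z - f infty,
      (countable_compl_of_isGδ ((IsGδ.singleton (f infty)).preimage f.continuous) rfl).mono
        fun z hz => sub_ne_zero.1 hz⟩
  have hinj : Function.Injective decompose := by
    intro f g hfg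
    ext z
    have hinf : f infty = g infty := congrArg Prod.fst hfg
    have hz : f z - f infty = g z - g infty := congrFun (congrArg (fun p => p.2.1) hfg) z
    rwa [hinf, sub_left_inj] at hz
  have hsupp : Cardinal.mk {g : C → ℝ // (Function.support g).Countable} ≤ Cardinal.continuum := by
    have hprod : max (Cardinal.mk (C × ℝ)) Cardinal.aleph0 ≤ Cardinal.continuum := by
      rw [Cardinal.mk_prod, Cardinal.lift_id, Cardinal.lift_id, Cardinal.mk_real]
      exact max_le ((mul_le_mul_left mk_le_continuum _).trans Cardinal.continuum_mul_self.le)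
        Cardinal.aleph0_le_continuum
    calc
      _ ≤ _ := mk_countable_support_le C ℝ
      _ ≤ Cardinal.continuum ^ Cardinal.aleph0 := Cardinal.power_le_power_right hprod
      _ = Cardinal.continuum := Cardinal.continuum_power_aleph0
  calc
    _ ≤ _ := Cardinal.mk_le_of_injective hinj
    _ = Cardinal.continuum * Cardinal.mk {g : C → ℝ // (Function.support g).Countable} := by
      rw [Cardinal.mk_prod, Cardinal.lift_id, Cardinal.lift_id, Cardinal.mk_real]
    _ ≤ Cardinal.continuum * Cardinal.continuum := by gcongr
    _ = Cardinal.continuum := Cardinal.continuum_mul_self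

end C

theorem CD.isLocallyConstant_val (n : ℕ) : IsLocallyConstant fun t : CD => t.val n :=
  IsLocallyConstant.iff_isOpen_fiber.2 (CD.isOpen_coord n)

theorem CD.denseRange_node : DenseRange CD.node := by
  rintro (s | x)
  · exact subset_closure (mem_range_self s)
  · refine mem_closure_iff.2 fun W hW hx => ?_
    obtain ⟨n, hn⟩ := CD.isOpen_iff.1 hW x hx
    refine ⟨CD.node (List.ofFn fun i : Fin n => x i), hn fun i hi => ?_, mem_range_self _⟩
    simp [CD.val, hi]

theorem continuous_e : Continuous e := continuous_stoneCechExtend _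

@[simp]
theorem e_stoneCechUnit (s : D) : e (stoneCechUnit s) = CD.node s :=
  stoneCechExtend_stoneCechUnit continuous_of_discreteTopology s

theorem e_surjective : Function.Surjective e := by
  have hsub : range CD.node ⊆ range e := range_subset_iff.2 fun s => ⟨_, e_stoneCechUnit s⟩
  rw [← range_eq_univ, ← (isCompact_range continuous_e).isClosed.closure_eq]
  exact (CD.denseRange_node.mono hsub).closure_eq

theorem e_eq_node_iff {v : StoneCech D} {s : D} : e v = CD.node s ↔ v = stoneCechUnit s := by
  have hinj : Function.Injective (e ∘ stoneCechUnit) := fun s t h => by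
    simpa only [Function.comp_apply, e_stoneCechUnit, CD.node.injEq] using h
  rw [← e_stoneCechUnit s]
  refine apply_eq_apply_iff_of_isOpen_singleton denseRange_stoneCechUnit continuous_e hinj ?_
  exact e_stoneCechUnit s ▸ CD.isOpen_node s

theorem isOpen_singleton_stoneCechUnit (s : D) : IsOpen {(stoneCechUnit s : StoneCech D)} := by
  have : {stoneCechUnit s} = e ⁻¹' {CD.node s} := by
    ext v
    exact e_eq_node_iff.symm
  exact this ▸ (CD.isOpen_node s).preimage continuous_e

theorem e_ne_branch_iff {v : StoneCech D} :
    (∀ y, e v ≠ CD.branch y) ↔ v ∈ range (stoneCechUnit : D → StoneCech D) := by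
  constructor
  · intro h
    rcases he : e v with s | y
    · exact ⟨s, (e_eq_node_iff.1 he).symm⟩
    · exact absurd he (h y)
  · rintro ⟨s, rfl⟩ y
    simp

theorem mem_K_iff {x : ℕ → Bool} {v : StoneCech D} : v ∈ K x ↔ e v = CD.branch x :=
  ⟨fun h => h.2, fun h => ⟨fun hv => e_ne_branch_iff.2 hv x h, h⟩⟩

theorem mem_plankSet_iff {p : C × StoneCech D} :
    p ∈ plankSet ↔ ∀ y, e p.2 = CD.branch y → p.1 = C.pt y := by
  have hmem : p ∈ plankSet ↔ p.2 ∈ range (stoneCechUnit : D → StoneCech D) ∨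
      ∃ x, p.1 = C.pt x ∧ e p.2 = CD.branch x := by
    simp [plankSet, mem_K_iff]
  rw [hmem, ← e_ne_branch_iff]
  constructor
  · rintro (h | ⟨x, hx, he⟩) y hy
    · exact absurd hy (h y)
    · rw [hx, CD.branch.inj (he.symm.trans hy)]
  · intro h
    by_cases! he : ∃ y, e p.2 = CD.branch y
    · exact Or.inr (he.imp fun y hy => ⟨h y hy, hy⟩)
    · exact Or.inl he

theorem mem_T_iff {a : A} : a ∈ T ↔ ∃ y, e a.1.2 = CD.branch y := by
  have hmem : a ∈ T ↔ ∃ x, a.1.1 = C.pt x ∧ e a.1.2 = CD.branch x := by simp [T, mem_K_iff]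
  rw [hmem]
  exact exists_congr fun y => and_iff_right_of_imp (mem_plankSet_iff.1 a.2 y)

theorem exists_mem_T_fst_eq_pt (x : ℕ → Bool) : ∃ a ∈ T, a.1.1 = C.pt x := by
  obtain ⟨v, hv⟩ := e_surjective (CD.branch x)
  have hmem : (C.pt x, v) ∈ plankSet :=
    mem_plankSet_iff.2 fun y hy => congrArg C.pt (CD.branch.inj (hv.symm.trans hy))
  exact ⟨⟨_, hmem⟩, mem_T_iff.2 ⟨x, hv⟩, rfl⟩

/-- At a point `(c, v)` outside the plank with `e v = y`, the countably many clopen conditions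
`c ≠ y` and `(e v) n = y n` have no common solution in the plank. -/
theorem realUltrafiltersConverge_A : RealUltrafiltersConverge A := by
  refine (C.realUltrafiltersConverge.prod .of_compactSpace).subtype fun p hp => ?_
  simp only [mem_plankSet_iff, not_forall] at hp
  obtain ⟨y, hy, hpy⟩ := hp
  refine ⟨fun n => {q | q.1 ∈ ({C.pt y} : Set C)ᶜ ∧ (e q.2).val n = some (y n)},
    fun n => ⟨?_, hpy, hy ▸ rfl⟩, fun q hq hqA => ?_⟩
  · exact ((C.isClopen_pt y).compl.preimage continuous_fst).inter
      (((CD.isLocallyConstant_val n).isClopen_fiber _).preimage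
        (continuous_e.comp continuous_snd))
  · rw [mem_iInter] at hq
    have he : e q.2 = CD.branch y := CD.val_injective (funext fun n => (hq n).2)
    exact (hq 0).1 (mem_plankSet_iff.1 hqA y he)

/-- The point `(c, d)` of `ℂ × D`, as a point of the plank. -/
def gridPoint (c : C) (d : D) : A := ⟨(c, stoneCechUnit d), Or.inl ⟨mem_univ _, mem_range_self d⟩⟩

theorem continuous_gridPoint (d : D) : Continuous fun c => gridPoint c d := by
  unfold gridPoint
  fun_prop

theorem gridPoint_notMem_T (c : C) (d : D) : gridPoint c d ∉ T := by
  simp [mem_T_iff, gridPoint]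

theorem eq_gridPoint_iff {a : A} {c : C} {d : D} :
    a = gridPoint c d ↔ a.1.1 = c ∧ a.1.2 = stoneCechUnit d := by
  rw [Subtype.ext_iff, Prod.ext_iff]
  rfl

theorem exists_eq_gridPoint_of_notMem_T {a : A} (ha : a ∉ T) : ∃ d, a = gridPoint a.1.1 d := by
  obtain ⟨d, hd⟩ := e_ne_branch_iff.1 (not_exists.1 (mt mem_T_iff.2 ha))
  exact ⟨d, eq_gridPoint_iff.2 ⟨rfl, hd.symm⟩⟩

theorem mem_R_iff {a : A} : a ∈ R ↔ ∃ d, a = gridPoint C.infty d := by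
  simp only [R, mem_ofPred_eq, mem_prod, mem_singleton_iff, mem_range, eq_gridPoint_iff,
    exists_and_left, eq_comm]

/-- The image of `(a, i)` in the quotient `Q`. -/
def mkQ (a : A) (i : Fin 2) : Q := Quotient.mk glue (a, i)

theorem isQuotientMap_mkQ : IsQuotientMap fun p : A × Fin 2 => mkQ p.1 p.2 :=
  isQuotientMap_quotient_mk'

theorem mkQ_eq_iff {a b : A} {i j : Fin 2} : mkQ a i = mkQ b j ↔ a = b ∧ (i = j ∨ a ∈ T) :=
  Quotient.eq (r := glue)

theorem exists_eq_mkQ (q : Q) : ∃ a i, q = mkQ a i := by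
  obtain ⟨⟨a, i⟩, rfl⟩ := isQuotientMap_mkQ.surjective q
  exact ⟨a, i, rfl⟩

/-- The map `Q → 𝔸` that folds the two copies of the plank together. -/
def toA : Q → A := Quotient.lift (fun p : A × Fin 2 => p.1) fun _ _ h => h.1

theorem continuous_toA : Continuous toA := continuous_fst.quotient_lift _

theorem continuous_fst_toA : Continuous fun q => (toA q).1.1 :=
  continuous_fst.comp (continuous_subtype_val.comp continuous_toA)

theorem continuous_snd_toA : Continuous fun q => (toA q).1.2 :=
  continuous_snd.comp (continuous_subtype_val.comp continuous_toA)

theorem isProperMap_toA : IsProperMap toA :=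
  isProperMap_of_comp_of_surj isQuotientMap_mkQ.continuous continuous_toA
    isProperMap_fst_of_compactSpace isQuotientMap_mkQ.surjective

theorem realUltrafiltersConverge_Q : RealUltrafiltersConverge Q :=
  realUltrafiltersConverge_A.of_isProperMap isProperMap_toA

/-- The point of `Q` that lies over `(c, d) ∈ ℂ × D` in the `i`-th copy of the plank, for
`p = (d, i)`. -/
def gridQ (c : C) (p : D × Fin 2) : Q := mkQ (gridPoint c p.1) p.2

theorem continuous_gridQ (p : D × Fin 2) : Continuous fun c => gridQ c p :=
  isQuotientMap_mkQ.continuous.comp ((continuous_gridPoint p.1).prodMk continuous_const)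

theorem mkQ_eq_gridQ_iff {a : A} {j : Fin 2} {c : C} {p : D × Fin 2} :
    mkQ a j = gridQ c p ↔ a = gridPoint c p.1 ∧ j = p.2 := by
  refine mkQ_eq_iff.trans (and_congr_right fun ha => or_iff_left ?_)
  exact ha ▸ gridPoint_notMem_T c p.1

theorem gridQ_inj {c c' : C} {p p' : D × Fin 2} : gridQ c p = gridQ c' p' ↔ c = c' ∧ p = p' := by
  refine ⟨fun h => ?_, fun ⟨hc, hp⟩ => hc ▸ hp ▸ rfl⟩
  obtain ⟨hpoint, hi⟩ := mkQ_eq_gridQ_iff.1 h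
  obtain ⟨hc, hd⟩ := eq_gridPoint_iff.1 hpoint
  have hd' : e (stoneCechUnit p.1) = e (stoneCechUnit p'.1) := congrArg e hd
  rw [e_stoneCechUnit, e_stoneCechUnit] at hd'
  exact ⟨hc, Prod.ext (CD.node.inj hd') hi⟩

/-- The set `ℂ × {d}` in the `i`-th copy of the plank, for `p = (d, i)`. -/
def row (p : D × Fin 2) : Set Q := range fun c => gridQ c p

theorem gridQ_mem_row_iff {c : C} {p p' : D × Fin 2} : gridQ c p ∈ row p' ↔ p = p' :=
  ⟨fun ⟨_, h⟩ => (gridQ_inj.1 h).2.symm, fun h => ⟨c, h ▸ rfl⟩⟩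

theorem mkQ_mem_row_iff {a : A} {j : Fin 2} {p : D × Fin 2} :
    mkQ a j ∈ row p ↔ a.1.2 = stoneCechUnit p.1 ∧ j = p.2 := by
  simp only [row, mem_range, eq_comm (b := mkQ a j), mkQ_eq_gridQ_iff, eq_gridPoint_iff]
  exact ⟨fun ⟨_, h, hj⟩ => ⟨h.2, hj⟩, fun ⟨h, hj⟩ => ⟨a.1.1, ⟨rfl, h⟩, hj⟩⟩

theorem isClopen_row (p : D × Fin 2) : IsClopen (row p) := by
  have hpre : (fun p : A × Fin 2 => mkQ p.1 p.2) ⁻¹' row p =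
      (fun q : A × Fin 2 => q.1.1.2) ⁻¹' {stoneCechUnit p.1} ∩ Prod.snd ⁻¹' {p.2} := by
    ext q
    exact mkQ_mem_row_iff
  rw [← isQuotientMap_mkQ.isClopen_preimage, hpre]
  exact (IsClopen.preimage ⟨isClosed_singleton, isOpen_singleton_stoneCechUnit p.1⟩
    (by fun_prop)).inter ((isClopen_discrete _).preimage continuous_snd)

instance : TotallySeparatedSpace Q := by
  refine totallySeparatedSpace_iff_exists_isClopen.2 fun q q' hne => ?_
  by_cases hfst : (toA q).1.1 = (toA q').1.1
  swap
  · exact exists_isClopen_of_apply_ne continuous_fst_toA hfst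
  by_cases hsnd : (toA q).1.2 = (toA q').1.2
  swap
  · exact exists_isClopen_of_apply_ne continuous_snd_toA hsnd
  obtain ⟨a, i, rfl⟩ := exists_eq_mkQ q
  obtain ⟨b, j, rfl⟩ := exists_eq_mkQ q'
  obtain rfl : a = b := Subtype.ext (Prod.ext hfst hsnd)
  have hij : i ≠ j := fun h => hne (h ▸ rfl)
  obtain ⟨d, hd⟩ := exists_eq_gridPoint_of_notMem_T fun hT => hne (mkQ_eq_iff.2 ⟨rfl, .inr hT⟩)
  have hd' := (eq_gridPoint_iff.1 hd).2
  exact ⟨row (d, i), isClopen_row _, mkQ_mem_row_iff.2 ⟨hd', rfl⟩,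
    fun h => hij (mkQ_mem_row_iff.1 h).2.symm⟩

theorem range_gridQ_infty : range (gridQ C.infty) = (fun q => (toA q).1.1) ⁻¹' {C.infty} := by
  refine Subset.antisymm (range_subset_iff.2 fun p => rfl) fun q hq => ?_
  obtain ⟨a, i, rfl⟩ := exists_eq_mkQ q
  have ha : a.1.1 = C.infty := hq
  have hT : a ∉ T := fun h => by
    obtain ⟨y, hy⟩ := mem_T_iff.1 h
    cases ha.symm.trans (mem_plankSet_iff.1 a.2 y hy)
  obtain ⟨d, hd⟩ := exists_eq_gridPoint_of_notMem_T hT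
  exact ⟨(d, i), (mkQ_eq_gridQ_iff.2 ⟨ha ▸ hd, rfl⟩).symm⟩

theorem isClosedEmbedding_gridQ_infty : IsClosedEmbedding (gridQ C.infty) := by
  refine isClosedEmbedding_of_isOpen_separating ?_ (fun p => (isClopen_row p).isOpen)
    fun _ _ => gridQ_mem_row_iff
  exact range_gridQ_infty ▸ C.isClosed_infty.preimage continuous_fst_toA

theorem isClosedEmbedding_gridQ_infty_slice (i : Fin 2) :
    IsClosedEmbedding fun d => gridQ C.infty (d, i) :=
  isClosedEmbedding_gridQ_infty.comp ⟨isEmbedding_prodMkLeft i, isClosed_discrete _⟩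

theorem RCopy_eq_range (i : Fin 2) : RCopy i = range fun d => gridQ C.infty (d, i) := by
  ext q
  constructor
  · rintro ⟨⟨a, j⟩, ⟨ha, rfl⟩, rfl⟩
    obtain ⟨d, rfl⟩ := mem_R_iff.1 ha
    exact ⟨d, rfl⟩
  · rintro ⟨d, rfl⟩
    exact ⟨(gridPoint C.infty d, i), ⟨mem_R_iff.2 ⟨d, rfl⟩, rfl⟩, rfl⟩

theorem RCopy_union_eq_range : RCopy 0 ∪ RCopy 1 = range (gridQ C.infty) := by
  ext q
  simp [RCopy_eq_range, Prod.exists, Fin.exists_fin_two, exists_or]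

theorem isClosedCopyOfNat_RCopy (i : Fin 2) : IsClosedCopyOfNat (RCopy i) :=
  RCopy_eq_range i ▸ .range (isClosedEmbedding_gridQ_infty_slice i)

theorem isClosedCopyOfNat_RCopy_union : IsClosedCopyOfNat (RCopy 0 ∪ RCopy 1) :=
  RCopy_union_eq_range ▸ .range isClosedEmbedding_gridQ_infty

theorem disjoint_RCopy : Disjoint (RCopy 0) (RCopy 1) := by
  rw [RCopy_eq_range, RCopy_eq_range, disjoint_range_iff]
  intro d d' h
  simpa using (gridQ_inj.1 h).2

theorem cStarEmbedded_RCopy (i : Fin 2) : CStarEmbedded (RCopy i) :=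
  RCopy_eq_range i ▸ .range_of_comp_eq_stoneCechUnit
    (isClosedEmbedding_gridQ_infty_slice i).continuous continuous_snd_toA fun _ => rfl

theorem mkQ_mem_closure_range_gridQ (a : A) (i : Fin 2) :
    mkQ a i ∈ closure (range fun d => gridQ a.1.1 (d, i)) := by
  have hne : (comap stoneCechUnit (𝓝 a.1.2)).NeBot :=
    isDenseInducing_stoneCechUnit.comap_nhds_neBot _
  have hgrid : Tendsto (gridPoint a.1.1) (comap stoneCechUnit (𝓝 a.1.2)) (𝓝 a) :=
    tendsto_subtype_rng.2 (tendsto_const_nhds.prodMk_nhds tendsto_comap)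
  exact mem_closure_of_tendsto
    ((isQuotientMap_mkQ.continuous.tendsto (a, i)).comp (hgrid.prodMk_nhds tendsto_const_nhds))
    (Eventually.of_forall mem_range_self)

theorem exists_pt_forall_gridQ_eq {Y : Type*} [TopologicalSpace Y] [T1Space Y]
    [FirstCountableTopology Y] (g : C(Q, Y)) :
    ∃ x, ∀ p, g (gridQ (C.pt x) p) = g (gridQ C.infty p) := by
  have hG : IsGδ (⋂ p, (fun c => g (gridQ c p)) ⁻¹' {g (gridQ C.infty p)}) :=
    .iInter fun p => (IsGδ.singleton _).preimage (g.continuous.comp (continuous_gridQ p))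
  obtain ⟨x, hx⟩ := C.exists_pt_mem_of_isGδ hG (mem_iInter.2 fun _ => rfl)
  exact ⟨x, mem_iInter.1 hx⟩

theorem eq_of_eq_const_on_RCopy {Y : Type*} [TopologicalSpace Y] [T1Space Y]
    [FirstCountableTopology Y] {g : C(Q, Y)} {y : Fin 2 → Y}
    (hg : ∀ i, ∀ q ∈ RCopy i, g q = y i) : y 0 = y 1 := by
  obtain ⟨x, hx⟩ := exists_pt_forall_gridQ_eq g
  obtain ⟨a, haT, ha⟩ := exists_mem_T_fst_eq_pt x
  have hrow : ∀ d i, g (gridQ a.1.1 (d, i)) = y i := fun d i =>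
    ha ▸ (hx (d, i)).trans (hg i _ (RCopy_eq_range i ▸ mem_range_self d))
  have htop : ∀ i, g (mkQ a i) = y i := fun i =>
    closure_minimal (range_subset_iff.2 fun d => hrow d i)
      (isClosed_singleton.preimage g.continuous) (mkQ_mem_closure_range_gridQ a i)
  have hglue : mkQ a 0 = mkQ a 1 := mkQ_eq_iff.2 ⟨rfl, .inr haT⟩
  rw [← htop 0, ← htop 1, hglue]

theorem not_cStarEmbedded_RCopy_union : ¬ CStarEmbedded (RCopy 0 ∪ RCopy 1) := by
  intro h
  obtain ⟨g, h0, h1⟩ := h.exists_eqOn_zero_one (isClosedCopyOfNat_RCopy 0).1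
    (isClosedCopyOfNat_RCopy 1).1 disjoint_RCopy
  exact zero_ne_one (α := ℝ) (eq_of_eq_const_on_RCopy (g := g) (y := ![0, 1])
    (Fin.forall_fin_two.2 ⟨h0, h1⟩))

theorem eq_of_forall_gridQ_eq {Y : Type*} [TopologicalSpace Y] [T2Space Y] {f g : C(Q, Y)}
    (h : ∀ c p, f (gridQ c p) = g (gridQ c p)) : f = g := by
  ext q
  obtain ⟨a, i, rfl⟩ := exists_eq_mkQ q
  have heq : EqOn f g (range fun d => gridQ a.1.1 (d, i)) :=
    forall_mem_range.2 fun d => h a.1.1 (d, i)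
  exact heq.closure f.continuous g.continuous (mkQ_mem_closure_range_gridQ a i)

theorem mk_continuousMap_Q : Cardinal.mk C(Q, ℝ) = Cardinal.continuum := by
  let restrict (f : C(Q, ℝ)) (p : D × Fin 2) : C(C, ℝ) := f.comp ⟨_, continuous_gridQ p⟩
  have hinj : Function.Injective restrict := fun f g hfg =>
    eq_of_forall_gridQ_eq fun c p => DFunLike.congr_fun (congrFun hfg p) c
  apply le_antisymm
  · calc
      Cardinal.mk C(Q, ℝ) ≤ Cardinal.mk (D × Fin 2 → C(C, ℝ)) := Cardinal.mk_le_of_injective hinj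
      _ = Cardinal.mk C(C, ℝ) ^ Cardinal.aleph0 := by
        rw [← Cardinal.power_def, Cardinal.mk_eq_aleph0 (D × Fin 2)]
      _ ≤ Cardinal.continuum ^ Cardinal.aleph0 :=
        Cardinal.power_le_power_right C.mk_continuousMap_le_continuum
      _ = Cardinal.continuum := Cardinal.continuum_power_aleph0
  · have hconst : Function.Injective (ContinuousMap.const Q : ℝ → C(Q, ℝ)) := fun _ _ h =>
      DFunLike.congr_fun h (gridQ C.infty ([], 0))
    exact Cardinal.mk_real ▸ Cardinal.mk_le_of_injective hconst

theorem exists_isClosedEmbedding_pi_of_continuum_le {I : Type*}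
    (hI : Cardinal.continuum ≤ Cardinal.mk I) :
    ∃ φ : Q → (I → ℝ), IsClosedEmbedding φ ∧ IsClosedCopyOfNat (φ '' (RCopy 0 ∪ RCopy 1)) ∧
      ¬ CStarEmbedded (φ '' (RCopy 0 ∪ RCopy 1)) := by
  have hemb : Nonempty (C(Q, ℝ) ↪ I) := by
    rw [← Cardinal.lift_mk_le', mk_continuousMap_Q, Cardinal.lift_continuum]
    simpa only [Cardinal.lift_uzero] using hI
  obtain ⟨φ, hφ⟩ := realUltrafiltersConverge_Q.exists_isClosedEmbedding_pi hemb
  exact ⟨φ, hφ, isClosedCopyOfNat_RCopy_union.image hφ,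
    fun h => not_cStarEmbedded_RCopy_union (h.of_image hφ.isEmbedding)⟩

end Plank

theorem mainTheorem3_general :
    Realcompact Plank.Q ∧
    (∀ i : Fin 2, IsClosedCopyOfNat (Plank.RCopy i) ∧ CStarEmbedded (Plank.RCopy i)) ∧
    Disjoint (Plank.RCopy 0) (Plank.RCopy 1) ∧
    IsClosedCopyOfNat (Plank.RCopy 0 ∪ Plank.RCopy 1) ∧
    ¬ CStarEmbedded (Plank.RCopy 0 ∪ Plank.RCopy 1) ∧
    Cardinal.mk C(Plank.Q, ℝ) = Cardinal.continuum ∧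
    (∀ I : Type u, Cardinal.continuum ≤ Cardinal.mk I →
      ∃ φ : Plank.Q → (I → ℝ), IsClosedEmbedding φ ∧
        IsClosedCopyOfNat (φ '' (Plank.RCopy 0 ∪ Plank.RCopy 1)) ∧
        ¬ CStarEmbedded (φ '' (Plank.RCopy 0 ∪ Plank.RCopy 1))) ∧
    ¬ (∀ (X : Type) [TopologicalSpace X], Realcompact X → ∀ N₁ N₂ : Set X,
      IsClosedCopyOfNat N₁ → IsClosedCopyOfNat N₂ → CStarEmbedded N₁ → CStarEmbedded N₂ →
        CStarEmbedded (N₁ ∪ N₂)) := by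
  have hQ : Realcompact Plank.Q := Plank.realUltrafiltersConverge_Q.realcompact
  have hR (i : Fin 2) := Plank.isClosedCopyOfNat_RCopy i
  have hRC (i : Fin 2) := Plank.cStarEmbedded_RCopy i
  refine ⟨hQ, fun i => ⟨hR i, hRC i⟩, Plank.disjoint_RCopy, Plank.isClosedCopyOfNat_RCopy_union,
    Plank.not_cStarEmbedded_RCopy_union, Plank.mk_continuousMap_Q,
    fun I hI => Plank.exists_isClosedEmbedding_pi_of_continuum_le hI, fun hunion => ?_⟩
  exact Plank.not_cStarEmbedded_RCopy_union
    (hunion Plank.Q hQ _ _ (hR 0) (hR 1) (hRC 0) (hRC 1))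

theorem mainTheorem3 :
    Realcompact Plank.Q ∧
    (∀ i : Fin 2, IsClosedCopyOfNat (Plank.RCopy i) ∧ CStarEmbedded (Plank.RCopy i)) ∧
    Disjoint (Plank.RCopy 0) (Plank.RCopy 1) ∧
    IsClosedCopyOfNat (Plank.RCopy 0 ∪ Plank.RCopy 1) ∧
    ¬ CStarEmbedded (Plank.RCopy 0 ∪ Plank.RCopy 1) ∧
    Cardinal.mk C(Plank.Q, ℝ) = Cardinal.continuum ∧
    (∀ I : Type u, Cardinal.mk I = Cardinal.continuum →
      ∃ φ : Plank.Q → (I → ℝ), IsClosedEmbedding φ ∧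
        IsClosedCopyOfNat (φ '' (Plank.RCopy 0 ∪ Plank.RCopy 1)) ∧
        ¬ CStarEmbedded (φ '' (Plank.RCopy 0 ∪ Plank.RCopy 1))) ∧
    ¬ (∀ (X : Type) [TopologicalSpace X], Realcompact X → ∀ N₁ N₂ : Set X,
      IsClosedCopyOfNat N₁ → IsClosedCopyOfNat N₂ → CStarEmbedded N₁ → CStarEmbedded N₂ →
        CStarEmbedded (N₁ ∪ N₂)) := by
  obtain ⟨hQ, hR, hdisj, hunion, hnot, hcard, hpow, hcons⟩ := mainTheorem3_general
  exact ⟨hQ, hR, hdisj, hunion, hnot, hcard, fun I hI => hpow I hI.ge, hcons⟩
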